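/- Let $N\ge 1$, let $r_1,\dots,r_n$ be nonzero integers with $\sum_{i=1}^n|r_i|\le 2N$, and let $$M(r_1,\dots,r_n;N)=\int_{U(N)}\prod_{i=1}^n \operatorname{tr}(U^{r_i})\,dU,$$ where $dU$ is the Haar measure on the group $U(N)$ of $N\times N$ unitary matrices, normalised to have total mass $1$. Let $s_1,\dots,s_m$ be the distinct values appearing in the list $|r_1|,\dots,|r_n|$, and for each $j$ let $a_j$ be the number of indices $i$ with $r_i=s_j$ and $b_j$ the number of indices $i$ with $r_i=-s_j$. Then $$M(r_1,\dots,r_n;N)=\begin{cases}\displaystyle\prod_{j=1}^m a_j!\,s_j^{a_j}, & \text{if } a_j=b_j \text{ for all } j=1,\dots,m,\\[1ex] 0, & \text{otherwise.}\end{cases}$$ -/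

import Mathlib

open MeasureTheory

/-- The unitary group `U(N)`, with the topology it inherits from the complex matrices. -/
abbrev UN (N : ℕ) : Type := Matrix.unitaryGroup (Fin N) ℂ

namespace UN

instance compactSpace (N : ℕ) : CompactSpace (UN N) := by
  have hc : IsClosed ((Matrix.unitaryGroup (Fin N) ℂ : Set (Matrix (Fin N) (Fin N) ℂ))) := by
    have h : (Matrix.unitaryGroup (Fin N) ℂ : Set (Matrix (Fin N) (Fin N) ℂ))
        = {A | A * star A = 1} := by
      ext A
      exact Matrix.mem_unitaryGroup_iff
    rw [h]
    exact isClosed_eq (by fun_prop) continuous_const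
  have hK : IsCompact ({A | ∀ i, A i ∈ {v : Fin N → ℂ | ∀ j, v j ∈ Metric.closedBall (0 : ℂ) 1}} :
      Set (Matrix (Fin N) (Fin N) ℂ)) :=
    isCompact_pi_infinite fun _ => isCompact_pi_infinite fun _ => isCompact_closedBall _ _
  exact isCompact_iff_compactSpace.mp <| hK.of_isClosed_subset hc fun A hA i j => by
    simpa using entry_norm_bound_of_unitary hA i j

/-- `U(N)` carries its Borel sigma-algebra. -/
noncomputable instance measurableSpace (N : ℕ) : MeasurableSpace (UN N) := borel (UN N)

instance borelSpace (N : ℕ) : BorelSpace (UN N) := ⟨rfl⟩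

/-- The normalised Haar measure on `U(N)`: the Haar measure giving the whole group mass `1`. -/
noncomputable def haar (N : ℕ) : Measure (UN N) :=
  Measure.haarMeasure (⊤ : TopologicalSpace.PositiveCompacts (UN N))

instance isHaarMeasure_haar (N : ℕ) : (haar N).IsHaarMeasure :=
  Measure.isHaarMeasure_haarMeasure _

instance isProbabilityMeasure_haar (N : ℕ) : IsProbabilityMeasure (haar N) :=
  ⟨Measure.haarMeasure_self⟩

/-- The trace of a unitary matrix. -/
noncomputable def tr {N : ℕ} (U : UN N) : ℂ := Matrix.trace (U : Matrix (Fin N) (Fin N) ℂ)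

/-- The average trace product `∫ ∏ i, tr (U ^ r i) dU` over `U(N)`; the powers are taken in the
group `U(N)`, so that negative exponents are powers of the inverse matrix. -/
noncomputable def avgTraceProd {n : ℕ} (r : Fin n → ℤ) (N : ℕ) : ℂ :=
  ∫ U : UN N, ∏ i, tr (U ^ r i) ∂(haar N)

/-- The integral in `avgTraceProd` is that of an integrable function. -/
theorem integrable_traceProd {n : ℕ} (r : Fin n → ℤ) (N : ℕ) :
    Integrable (fun U : UN N => ∏ i, tr (U ^ r i)) (haar N) := by
  have hc : Continuous (fun U : UN N => ∏ i, tr (U ^ r i)) := by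
    refine continuous_finsetProd _ fun i _ => ?_
    exact (continuous_subtype_val.comp (continuous_zpow (r i))).matrix_trace
  exact hc.integrable_of_hasCompactSupport (HasCompactSupport.of_compactSpace _)

end UN

/-! The moments of traces and those of independent complex Gaussians `Z j` of variance `j` satisfy
the same linear recursion, which has at most one solution in the range considered. On the unitary
side, invariance of Haar measure under `U ↦ exp (i t A) U`, applied to an entry of `U ^ k` times a
trace product, gives the loop equations (`traceMoment_loop`): `tr (U ^ k)` is cut into two traces,
or joined with another factor of the product. On the Gaussian side the same equations follow from
Wick's formula (`gaussianMoment_loop`). Uniqueness (`eq_zero_of_loop`) is a maximum principle. With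
positive and negative exponents both of total size `K ≤ N`, one cut produces the factor `tr 1 = N`,
while the other terms of that degree have total weight `K - 1 < N`; joins with negative exponents
lower the degree. Lists with nonzero sum have zero moment on both sides, so `∑ |r i| ≤ 2 N` leaves
exactly the case `K ≤ N`. -/

/-! ### Gaussian moments and their loop equations -/

/-- The contribution of the index `j` to `gaussianMoment N s`. -/
noncomputable def gaussianFactor (N : ℕ) (s : Multiset ℤ) (j : ℤ) : ℂ :=
  if 0 < j then
    if s.count j = s.count (-j) then (Nat.factorial (s.count j) : ℂ) * (j : ℂ) ^ s.count j else 0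
  else if j = 0 then (N : ℂ) ^ s.count 0 else 1

/-- The mixed moment `𝔼 ∏_{j ∈ s} Z j`, where the `Z j` with `0 < j` are independent centred complex
Gaussians of variance `j`, `Z (-j)` is the conjugate of `Z j`, and `Z 0 = N`. -/
noncomputable def gaussianMoment (N : ℕ) (s : Multiset ℤ) : ℂ := ∏ᶠ j, gaussianFactor N s j

theorem hasFiniteMulSupport_gaussianFactor (N : ℕ) (s : Multiset ℤ) :
    Function.HasFiniteMulSupport (gaussianFactor N s) := by
  refine Set.Finite.subset (s.toFinset ∪ s.toFinset.image (fun j => -j)).finite_toSet fun j hj => ?_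
  by_contra h
  have h1 : j ∉ s := fun hm => h (by simp [hm])
  have h2 : -j ∉ s := fun hm => h (by simp [hm])
  refine hj ?_
  unfold gaussianFactor
  split_ifs with h3 h4 h5
  · simp [Multiset.count_eq_zero_of_notMem h1]
  · simp [Multiset.count_eq_zero_of_notMem h1, Multiset.count_eq_zero_of_notMem h2] at h4
  · subst h5
    simp [Multiset.count_eq_zero_of_notMem h1]
  · rfl

theorem gaussianMoment_zero (N : ℕ) : gaussianMoment N 0 = 1 := by
  unfold gaussianMoment
  convert finprod_one with j
  simp [gaussianFactor]

/-- Isolates the one factor in which two multisets differ, so that their moments can be compared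
there. -/
theorem gaussianMoment_eq_factor_mul {N : ℕ} {s t : Multiset ℤ} (a : ℤ)
    (h : ∀ j, j ≠ a → gaussianFactor N t j = gaussianFactor N s j) :
    gaussianMoment N t =
      gaussianFactor N t a * ∏ᶠ (j) (_ : j ≠ a), gaussianFactor N s j := by
  rw [gaussianMoment, ← mul_finprod_cond_ne a (hasFiniteMulSupport_gaussianFactor N t)]
  congr 1
  exact finprod_congr fun j => finprod_congr fun hj => h j hj

theorem gaussianMoment_zero_cons (N : ℕ) (s : Multiset ℤ) :
    gaussianMoment N (0 ::ₘ s) = N * gaussianMoment N s := by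
  rw [gaussianMoment_eq_factor_mul (s := s) (t := 0 ::ₘ s) 0,
    gaussianMoment_eq_factor_mul (s := s) (t := s) 0 fun _ _ => rfl]
  · simp only [gaussianFactor, lt_irrefl, if_false, if_true, Multiset.count_cons_self]
    ring
  · intro j hj
    simp [gaussianFactor, Multiset.count_cons_of_ne hj,
      Multiset.count_cons_of_ne (neg_ne_zero.mpr hj), hj]

/-- Wick's formula for the Gaussian moments. -/
theorem gaussianMoment_cons (N : ℕ) {a : ℤ} (ha : a ≠ 0) (s : Multiset ℤ) :
    gaussianMoment N (a ::ₘ s) =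
      |a| * s.count (-a) * gaussianMoment N (s.erase (-a)) := by
  have hna : -a ≠ a := by omega
  have habs : 0 < |a| := abs_pos.mpr ha
  have h1 : ∀ j, j ≠ |a| → gaussianFactor N (a ::ₘ s) j = gaussianFactor N s j := by
    intro j hj
    unfold gaussianFactor
    by_cases hj0 : 0 < j
    · have : j ≠ a := by rintro rfl; exact hj (abs_of_pos hj0).symm
      have : -j ≠ a := by rintro rfl; simp [abs_of_pos hj0] at hj
      simp [*]
    · simp [hj0, Multiset.count_cons_of_ne ha.symm]
  have h2 : ∀ j, j ≠ |a| → gaussianFactor N (s.erase (-a)) j = gaussianFactor N s j := by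
    intro j hj
    unfold gaussianFactor
    by_cases hj0 : 0 < j
    · have h3 : j ≠ -a := by rintro rfl; rw [← abs_neg, abs_of_pos hj0] at hj; exact hj rfl
      have h4 : -j ≠ -a := by rintro h; rw [neg_inj.mp h, abs_of_pos (by omega)] at hj; exact hj rfl
      simp [hj0, Multiset.count_erase_of_ne h3, Multiset.count_erase_of_ne h4]
    · simp [hj0, Multiset.count_erase_of_ne (neg_ne_zero.mpr ha).symm]
  rw [gaussianMoment_eq_factor_mul _ h1, gaussianMoment_eq_factor_mul _ h2, ← mul_assoc]
  congr 1
  unfold gaussianFactor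
  simp only [habs, if_true]
  -- For either sign, both sides vanish if `-a` is absent from `s`; if it occurs `c + 1` times, the
  -- identity is `(c + 1)! |a| ^ (c + 1) = |a| (c + 1) * (c! |a| ^ c)`.
  rcases lt_or_gt_of_ne ha with h | h
  · rw [abs_of_neg h, neg_neg]
    simp only [Multiset.count_cons_self, Multiset.count_cons_of_ne hna, Multiset.count_erase_self,
      Multiset.count_erase_of_ne hna.symm]
    rcases hc : s.count (-a) with _ | c
    · simp
    · by_cases h' : c = s.count a
      · simp [h', Nat.factorial_succ, pow_succ]
        ring
      · simp [h']
  · rw [abs_of_pos h]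
    simp only [Multiset.count_cons_self, Multiset.count_cons_of_ne hna, Multiset.count_erase_self,
      Multiset.count_erase_of_ne hna.symm]
    rcases hc : s.count (-a) with _ | c
    · simp
    · by_cases h' : s.count a = c
      · simp [h', Nat.factorial_succ, pow_succ]
        ring
      · simp [h']

/-- The Gaussian moments solve the loop equations of the unitary group. -/
theorem gaussianMoment_loop (N k : ℕ) (s : Multiset ℤ) :
    ∑ l ∈ Finset.range k, gaussianMoment N ((l : ℤ) ::ₘ ((k : ℤ) - l) ::ₘ s) +
      (s.map fun m : ℤ => (m : ℂ) * gaussianMoment N ((k + m) ::ₘ s.erase m)).sum = 0 := by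
  -- `h m` collects all joins with `m`. By Wick's formula the cuts cancel `h` on `[-k, 0)`, and
  -- outside `[-k, 0]` the function `h` is odd under the reflection `m ↦ -k - m`.
  set h : ℤ → ℂ := fun m => s.count m * ((m : ℂ) * gaussianMoment N ((k + m) ::ₘ s.erase m)) with hh
  have hcut : ∀ l ∈ Finset.range k,
      gaussianMoment N ((l : ℤ) ::ₘ ((k : ℤ) - l) ::ₘ s) = -h ((l : ℤ) - k) := by
    intro l hl
    have hl' : (l : ℤ) < k := by exact_mod_cast Finset.mem_range.mp hl
    have hne : -((k : ℤ) - l) ≠ l := by omega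
    rw [Multiset.cons_swap, gaussianMoment_cons N (by omega), abs_of_pos (by omega),
      Multiset.count_cons_of_ne hne, Multiset.erase_cons_tail _ hne.symm]
    simp only [hh, neg_sub, add_sub_cancel]
    push_cast
    ring
  have hjoin : ∀ m : ℤ, m < -k ∨ 0 < m → h (-k - m) = -h m := by
    have key : ∀ m : ℤ, 0 < m → h (-k - m) = -h m := by
      intro m hm
      have e1 : (k : ℤ) + (-k - m) = -m := by ring
      have e2 : -((k : ℤ) + m) = -k - m := by ring
      have hne : m ≠ -k - m := by omega
      simp only [hh, e1]
      rw [gaussianMoment_cons N (show -m ≠ 0 by omega),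
        gaussianMoment_cons N (show (k : ℤ) + m ≠ 0 by omega),
        abs_neg, neg_neg, e2, abs_of_pos hm, abs_of_pos (by omega), Multiset.count_erase_of_ne hne,
        Multiset.count_erase_of_ne hne.symm, Multiset.erase_comm]
      push_cast
      ring
    rintro m (hm | hm)
    · have := key (-k - m) (by omega)
      rw [sub_sub_cancel] at this
      rw [this, neg_neg]
    · exact key m hm
  have hsum : (s.map fun m : ℤ => (m : ℂ) * gaussianMoment N ((k + m) ::ₘ s.erase m)).sum =
      ∑ m ∈ s.toFinset, h m := by
    rw [Finset.sum_multiset_map_count]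
    simp [hh]
  obtain ⟨B, hB⟩ : ∃ B : ℕ, ∀ m ∈ s.toFinset, m.natAbs ≤ B :=
    ⟨s.toFinset.sup Int.natAbs, fun m hm => Finset.le_sup (f := Int.natAbs) hm⟩
  -- This interval is stable under `m ↦ -k - m`.
  have hsub : s.toFinset ⊆ Finset.Icc (-(k : ℤ) - B) B := by
    intro m hm
    have := hB m hm
    rw [Finset.mem_Icc]
    omega
  rw [hsum, Finset.sum_subset hsub, Finset.sum_congr rfl hcut]
  · set g : ℤ → ℂ := fun m => if m < -k ∨ 0 < m then h m else 0 with hg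
    have hg0 : ∑ m ∈ Finset.Icc (-(k : ℤ) - B) B, g m = 0 := by
      have : ∑ m ∈ Finset.Icc (-(k : ℤ) - B) B, g m = ∑ m ∈ Finset.Icc (-(k : ℤ) - B) B, -g m := by
        refine Finset.sum_nbij' (fun m => -k - m) (fun m => -k - m) ?_ ?_ ?_ ?_ ?_
        · intro m hm; rw [Finset.mem_Icc] at *; omega
        · intro m hm; rw [Finset.mem_Icc] at *; omega
        · intro m _; simp
        · intro m _; simp
        · intro m _
          simp only [hg]
          by_cases hm : m < -k ∨ 0 < m
          · rw [if_pos hm, if_pos (by omega), hjoin m hm, neg_neg]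
          · rw [if_neg hm, if_neg (by omega), neg_zero]
      rw [Finset.sum_neg_distrib] at this
      exact self_eq_neg.mp this
    have hr : ∑ l ∈ Finset.range k, h ((l : ℤ) - k) =
        ∑ m ∈ Finset.Icc (-(k : ℤ) - B) B, (h m - g m) := by
      have hI : ∑ l ∈ Finset.range k, h ((l : ℤ) - k) =
          ∑ m ∈ Finset.Ico (-(k : ℤ)) 0, (h m - g m) := by
        refine Finset.sum_nbij' (fun l => (l : ℤ) - k) (fun m => (m + k).toNat) ?_ ?_ ?_ ?_ ?_
        · intro l hl; rw [Finset.mem_range] at hl; rw [Finset.mem_Ico]; omega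
        · intro m hm; rw [Finset.mem_Ico] at hm; rw [Finset.mem_range]; omega
        · intro l _; simp
        · intro m hm; rw [Finset.mem_Ico] at hm; omega
        · intro l hl
          rw [Finset.mem_range] at hl
          simp only [hg]
          rw [if_neg (by omega), sub_zero]
      rw [hI]
      refine Finset.sum_subset ?_ ?_
      · intro m hm; rw [Finset.mem_Ico] at hm; rw [Finset.mem_Icc]; omega
      · intro m _ hm
        rw [Finset.mem_Ico] at hm
        simp only [hg]
        -- The fixed gap `m = 0` contributes nothing, because `h` carries the factor `m`.
        by_cases hm0 : m = 0
        · simp [hm0, hh]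
        · rw [if_pos (by omega), sub_self]
    rw [Finset.sum_neg_distrib, hr, Finset.sum_sub_distrib, hg0]
    ring
  · intro m _ hm
    simp only [hh]
    rw [Multiset.count_eq_zero_of_notMem (by simpa using hm)]
    simp

/-! ### Differentiation along one-parameter subgroups -/

namespace UN

open scoped Matrix.Norms.L2Operator

variable {N : ℕ}

/-- The one-parameter subgroup `t ↦ exp (i t A)` of the unitary group. -/
noncomputable def oneParam (A : selfAdjoint (Matrix (Fin N) (Fin N) ℂ)) (t : ℝ) : UN N :=
  selfAdjoint.expUnitary (t • A)

theorem oneParam_zero (A : selfAdjoint (Matrix (Fin N) (Fin N) ℂ)) : oneParam A 0 = 1 := by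
  simp [oneParam]

theorem oneParam_add (A : selfAdjoint (Matrix (Fin N) (Fin N) ℂ)) (s t : ℝ) :
    oneParam A (s + t) = oneParam A s * oneParam A t := by
  unfold oneParam
  rw [add_smul]
  exact Commute.expUnitary_add (((Commute.refl _).smul_left s).smul_right t)

theorem hasDerivAt_coe_oneParam (A : selfAdjoint (Matrix (Fin N) (Fin N) ℂ)) :
    HasDerivAt (fun t => (oneParam A t : Matrix (Fin N) (Fin N) ℂ))
      (Complex.I • (A : Matrix (Fin N) (Fin N) ℂ)) 0 := by
  have h := hasDerivAt_exp_smul_const (𝕂 := ℝ) (Complex.I • (A : Matrix (Fin N) (Fin N) ℂ)) 0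
  simp only [zero_smul, NormedSpace.exp_zero, one_mul] at h
  refine h.congr_of_eventuallyEq (Filter.Eventually.of_forall fun t => ?_)
  simp only [oneParam, selfAdjoint.expUnitary_coe, selfAdjoint.val_smul]
  rw [smul_comm]

/-- `g` is the derivative of `f` at each point `U` along `t ↦ exp (i t A) U`. -/
def HasLieDeriv (A : selfAdjoint (Matrix (Fin N) (Fin N) ℂ)) (f g : UN N → ℂ) : Prop :=
  ∀ U, HasDerivAt (fun t : ℝ => f (oneParam A t * U)) (g U) 0

/-- The group law moves the base point from time `0` to time `t`; differentiation under the integral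
needs all times. -/
theorem HasLieDeriv.hasDerivAt {A : selfAdjoint (Matrix (Fin N) (Fin N) ℂ)} {f g : UN N → ℂ}
    (h : HasLieDeriv A f g) (U : UN N) (t : ℝ) :
    HasDerivAt (fun t : ℝ => f (oneParam A t * U)) (g (oneParam A t * U)) t := by
  have h1 := h (oneParam A t * U)
  have h2 : HasDerivAt (fun u : ℝ => u - t) 1 t := (hasDerivAt_id t).sub_const t
  rw [show (0 : ℝ) = t - t by ring] at h1
  have h3 := HasDerivAt.scomp (h := fun u : ℝ => u - t) t h1 h2
  simp only [one_smul] at h3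
  refine h3.congr_of_eventuallyEq (Filter.Eventually.of_forall fun u => ?_)
  simp only [Function.comp]
  rw [← mul_assoc, ← oneParam_add, sub_add_cancel]

theorem integrable_of_continuous {f : UN N → ℂ} (hf : Continuous f) : Integrable f (haar N) :=
  hf.integrable_of_hasCompactSupport (HasCompactSupport.of_compactSpace _)

/-- The Haar integral of a derivative along a one-parameter subgroup vanishes. -/
theorem HasLieDeriv.integral_eq_zero {A : selfAdjoint (Matrix (Fin N) (Fin N) ℂ)} {f g : UN N → ℂ}
    (h : HasLieDeriv A f g) (hf : Continuous f) (hg : Continuous g) :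
    ∫ U, g U ∂haar N = 0 := by
  obtain ⟨C, hC⟩ := IsCompact.exists_bound_of_continuousOn isCompact_univ hg.continuousOn
  have h1 := (hasDerivAt_integral_of_dominated_loc_of_deriv_le (μ := haar N) (x₀ := (0 : ℝ))
    (s := Set.univ) (F := fun t U => f (oneParam A t * U)) (F' := fun t U => g (oneParam A t * U))
    (bound := fun _ => C) Filter.univ_mem
    (Filter.Eventually.of_forall fun t =>
      (integrable_of_continuous (hf.comp (continuous_const_mul _))).aestronglyMeasurable)
    (integrable_of_continuous (hf.comp (continuous_const_mul _)))
    (integrable_of_continuous (hg.comp (continuous_const_mul _))).aestronglyMeasurable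
    (Filter.Eventually.of_forall fun U t _ => hC _ (Set.mem_univ _)) (integrable_const _)
    (Filter.Eventually.of_forall fun U t _ => h.hasDerivAt U t)).2
  -- By left invariance the integral does not depend on `t`.
  simp only [integral_mul_left_eq_self f, oneParam_zero, one_mul] at h1
  exact h1.unique (hasDerivAt_const _ _)

theorem HasLieDeriv.mul {A : selfAdjoint (Matrix (Fin N) (Fin N) ℂ)} {f g f' g' : UN N → ℂ}
    (h : HasLieDeriv A f g) (h' : HasLieDeriv A f' g') :
    HasLieDeriv A (fun U => f U * f' U) (fun U => g U * f' U + f U * g' U) := fun U => by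
  simpa [oneParam_zero] using! (h U).mul (h' U)

theorem hasDerivAt_coe_pow (A : selfAdjoint (Matrix (Fin N) (Fin N) ℂ)) (k : ℕ) (U : UN N) :
    HasDerivAt (fun t => (((oneParam A t * U) ^ k : UN N) : Matrix (Fin N) (Fin N) ℂ))
      (∑ l ∈ Finset.range k, ((U ^ l : UN N) : Matrix (Fin N) (Fin N) ℂ) *
        (Complex.I • (A : Matrix (Fin N) (Fin N) ℂ)) *
          ((U ^ (k - l) : UN N) : Matrix (Fin N) (Fin N) ℂ)) 0 := by
  induction k with
  | zero => simpa using hasDerivAt_const (0 : ℝ) (1 : Matrix (Fin N) (Fin N) ℂ)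
  | succ k ih =>
    have h := ih.mul ((hasDerivAt_coe_oneParam A).mul_const (U : Matrix (Fin N) (Fin N) ℂ))
    simp only [oneParam_zero, one_mul] at h
    convert! h using 1
    rw [Finset.sum_range_succ, Finset.sum_mul]
    congr 1
    · refine Finset.sum_congr rfl fun l hl => ?_
      rw [Nat.sub_add_comm (Finset.mem_range.mp hl).le, pow_succ]
      simp [mul_assoc]
    · simp [mul_assoc]

theorem hasLieDeriv_entry (A : selfAdjoint (Matrix (Fin N) (Fin N) ℂ)) (k : ℕ) (i j : Fin N) :
    HasLieDeriv A (fun U => ((U ^ k : UN N) : Matrix (Fin N) (Fin N) ℂ) i j)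
      (fun U => ∑ l ∈ Finset.range k, (((U ^ l : UN N) : Matrix (Fin N) (Fin N) ℂ) *
        (Complex.I • (A : Matrix (Fin N) (Fin N) ℂ)) *
          ((U ^ (k - l) : UN N) : Matrix (Fin N) (Fin N) ℂ)) i j) := fun U => by
  have h := (((Matrix.entryLinearMap ℝ ℂ i j).toContinuousLinearMap).hasFDerivAt).comp_hasDerivAt
    (0 : ℝ) (hasDerivAt_coe_pow A k U)
  simpa [Function.comp_def, Matrix.sum_apply] using! h

theorem tr_zpow_neg (U : UN N) (m : ℤ) : tr (U ^ (-m)) = star (tr (U ^ m)) := by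
  rw [zpow_neg, tr, tr, ← Matrix.trace_conjTranspose]
  rfl

theorem hasLieDeriv_tr_pow (A : selfAdjoint (Matrix (Fin N) (Fin N) ℂ)) (k : ℕ) :
    HasLieDeriv A (fun U => tr (U ^ k))
      (fun U => k * Matrix.trace ((Complex.I • (A : Matrix (Fin N) (Fin N) ℂ)) *
          ((U ^ k : UN N) : Matrix (Fin N) (Fin N) ℂ))) := fun U => by
  have h := (((Matrix.traceLinearMap (Fin N) ℝ ℂ).toContinuousLinearMap).hasFDerivAt
    ).comp_hasDerivAt (0 : ℝ) (hasDerivAt_coe_pow A k U)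
  convert! h using 1
  have : ∀ l ∈ Finset.range k, Matrix.trace (((U ^ l : UN N) : Matrix (Fin N) (Fin N) ℂ) *
        (Complex.I • (A : Matrix (Fin N) (Fin N) ℂ)) *
          ((U ^ (k - l) : UN N) : Matrix (Fin N) (Fin N) ℂ)) =
      Matrix.trace ((Complex.I • (A : Matrix (Fin N) (Fin N) ℂ)) *
          ((U ^ k : UN N) : Matrix (Fin N) (Fin N) ℂ)) := by
    intro l hl
    rw [Matrix.trace_mul_cycle, Matrix.trace_mul_comm, ← Submonoid.coe_mul, ← pow_add,
      Nat.sub_add_cancel (Finset.mem_range.mp hl).le]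
  have h2 := Finset.sum_congr rfl this
  simp only [Finset.sum_const, Finset.card_range, nsmul_eq_mul] at h2
  beta_reduce
  rw [← h2, ← Matrix.trace_sum]
  rfl

theorem hasLieDeriv_tr_zpow (A : selfAdjoint (Matrix (Fin N) (Fin N) ℂ)) (m : ℤ) :
    HasLieDeriv A (fun U => tr (U ^ m))
      (fun U => m * Matrix.trace ((Complex.I • (A : Matrix (Fin N) (Fin N) ℂ)) *
          ((U ^ m : UN N) : Matrix (Fin N) (Fin N) ℂ))) := by
  obtain ⟨k, rfl | rfl⟩ := m.eq_nat_or_neg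
  · simpa using hasLieDeriv_tr_pow A k
  -- Negative powers follow by complex conjugation, since `A` is self-adjoint and `U` unitary.
  · intro U
    have h := (hasLieDeriv_tr_pow A k U).star
    simp only [tr_zpow_neg, zpow_natCast]
    convert! h using 1
    beta_reduce
    rw [star_mul', ← Matrix.trace_conjTranspose, Matrix.conjTranspose_mul,
      Matrix.conjTranspose_smul, Matrix.trace_mul_comm]
    have hA : (A : Matrix (Fin N) (Fin N) ℂ).conjTranspose = A := A.2
    have hU : ((U ^ k : UN N) : Matrix (Fin N) (Fin N) ℂ).conjTranspose =
      ((U ^ (-(k : ℤ)) : UN N) : Matrix (Fin N) (Fin N) ℂ) := by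
      rw [zpow_neg, zpow_natCast]
      rfl
    rw [hA, hU]
    simp

/-- The product of the traces of the powers of `U` with exponents in `s`. -/
noncomputable def trProd (s : Multiset ℤ) (U : UN N) : ℂ := (s.map fun m => tr (U ^ m)).prod

theorem hasLieDeriv_trProd (A : selfAdjoint (Matrix (Fin N) (Fin N) ℂ)) (s : Multiset ℤ) :
    HasLieDeriv A (trProd s)
      (fun U => (s.map fun m : ℤ => m * Matrix.trace ((Complex.I • (A : Matrix (Fin N) (Fin N) ℂ)) *
          ((U ^ m : UN N) : Matrix (Fin N) (Fin N) ℂ)) * trProd (s.erase m) U).sum) := by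
  induction s using Multiset.induction_on with
  | empty => intro U; simpa [trProd] using hasDerivAt_const (0 : ℝ) (1 : ℂ)
  | cons a s ih =>
    have h := (hasLieDeriv_tr_zpow A a).mul ih
    intro U
    convert! h U using 1
    · simp [trProd]
    · beta_reduce
      rw [Multiset.map_cons, Multiset.sum_cons, Multiset.erase_cons_head]
      congr 1
      rw [← Multiset.sum_map_mul_left]
      congr 1
      refine Multiset.map_congr rfl fun m hm => ?_
      by_cases hma : m = a
      · subst hma
        rw [Multiset.erase_cons_head]
        nth_rw 1 [← Multiset.cons_erase hm]
        simp only [trProd, Multiset.map_cons, Multiset.prod_cons]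
        ring
      · rw [Multiset.erase_cons_tail _ (Ne.symm hma)]
        simp only [trProd, Multiset.map_cons, Multiset.prod_cons]
        ring

end UN

/-! ### Loop equations for the trace moments -/

namespace UN

variable {N : ℕ}

theorem continuous_coe_zpow (m : ℤ) :
    Continuous fun U : UN N => ((U ^ m : UN N) : Matrix (Fin N) (Fin N) ℂ) :=
  continuous_subtype_val.comp (continuous_zpow m)

theorem continuous_coe_pow (k : ℕ) :
    Continuous fun U : UN N => ((U ^ k : UN N) : Matrix (Fin N) (Fin N) ℂ) :=
  continuous_subtype_val.comp (continuous_pow k)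

theorem continuous_trProd (s : Multiset ℤ) : Continuous (trProd s : UN N → ℂ) := by
  unfold trProd
  exact continuous_multiset_prod _ fun m _ => (continuous_coe_zpow m).matrix_trace

/-- The expression which, for `X = i A`, is the derivative of `(U ^ k) i j * trProd s U` along
`t ↦ exp (i t A) U`. -/
noncomputable def entryDeriv (k : ℕ) (s : Multiset ℤ) (i j : Fin N) (X : Matrix (Fin N) (Fin N) ℂ)
    (U : UN N) : ℂ :=
  (∑ l ∈ Finset.range k, (((U ^ l : UN N) : Matrix (Fin N) (Fin N) ℂ) * X *
    ((U ^ (k - l) : UN N) : Matrix (Fin N) (Fin N) ℂ)) i j) * trProd s U +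
  ((U ^ k : UN N) : Matrix (Fin N) (Fin N) ℂ) i j * ∑ m ∈ s.toFinset, s.count m *
    (m * Matrix.trace (X * ((U ^ m : UN N) : Matrix (Fin N) (Fin N) ℂ)) * trProd (s.erase m) U)

theorem continuous_entryDeriv (k : ℕ) (s : Multiset ℤ) (i j : Fin N)
    (X : Matrix (Fin N) (Fin N) ℂ) : Continuous (entryDeriv k s i j X) := by
  unfold entryDeriv
  refine ((continuous_finsetSum _ fun l _ => ?_).mul (continuous_trProd s)).add
    (((continuous_coe_pow k).matrix_elem i j).mul (continuous_finsetSum _ fun m _ =>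
      continuous_const.mul ((continuous_const.mul ?_).mul (continuous_trProd _))))
  · exact (((continuous_coe_pow l).mul continuous_const).mul (continuous_coe_pow _)).matrix_elem i j
  · exact (continuous_const.mul (continuous_coe_zpow m)).matrix_trace

theorem entryDeriv_add (k : ℕ) (s : Multiset ℤ) (i j : Fin N) (X Y : Matrix (Fin N) (Fin N) ℂ)
    (U : UN N) :
    entryDeriv k s i j (X + Y) U = entryDeriv k s i j X U + entryDeriv k s i j Y U := by
  simp only [entryDeriv, mul_add, add_mul, Matrix.add_apply, Finset.sum_add_distrib,
    Matrix.trace_add]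
  ring

theorem entryDeriv_smul (k : ℕ) (s : Multiset ℤ) (i j : Fin N) (c : ℂ)
    (X : Matrix (Fin N) (Fin N) ℂ) (U : UN N) :
    entryDeriv k s i j (c • X) U = c * entryDeriv k s i j X U := by
  simp only [entryDeriv, mul_add, Finset.mul_sum, Finset.sum_mul, Matrix.mul_smul, Matrix.smul_mul,
    Matrix.smul_apply, Matrix.trace_smul, smul_eq_mul]
  congr 1
  · exact Finset.sum_congr rfl fun _ _ => by ring
  · exact Finset.sum_congr rfl fun _ _ => by ring

/-- Only `X = i A` with `A` self-adjoint is tangent to the group, but `entryDeriv` is complex linear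
in `X`, and every matrix is a self-adjoint one plus `i` times another. This admits matrix units for
`X`. -/
theorem integral_entryDeriv (k : ℕ) (s : Multiset ℤ) (i j : Fin N)
    (X : Matrix (Fin N) (Fin N) ℂ) : ∫ U, entryDeriv k s i j X U ∂haar N = 0 := by
  have hself : ∀ A : selfAdjoint (Matrix (Fin N) (Fin N) ℂ),
      ∫ U, entryDeriv k s i j (Complex.I • (A : Matrix (Fin N) (Fin N) ℂ)) U ∂haar N = 0 := by
    intro A
    refine HasLieDeriv.integral_eq_zero (A := A)
      (f := fun U => ((U ^ k : UN N) : Matrix (Fin N) (Fin N) ℂ) i j * trProd s U) ?_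
      (((continuous_coe_pow k).matrix_elem i j).mul (continuous_trProd s))
      (continuous_entryDeriv k s i j _)
    convert (hasLieDeriv_entry A k i j).mul (hasLieDeriv_trProd A s) using 2 with U
    simp only [entryDeriv, Finset.sum_multiset_map_count, nsmul_eq_mul]
  have hself' : ∀ A : selfAdjoint (Matrix (Fin N) (Fin N) ℂ),
      ∫ U, entryDeriv k s i j (A : Matrix (Fin N) (Fin N) ℂ) U ∂haar N = 0 := by
    intro A
    have h := hself A
    simp only [entryDeriv_smul, integral_const_mul] at h
    exact (mul_eq_zero.mp h).resolve_left Complex.I_ne_zero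
  rw [← realPart_add_I_smul_imaginaryPart X]
  simp only [entryDeriv_add]
  rw [integral_add (integrable_of_continuous (continuous_entryDeriv ..))
    (integrable_of_continuous (continuous_entryDeriv ..)), hself, hself', add_zero]

/-- The moment `∫ ∏ m ∈ s, tr (U ^ m) dU`. -/
noncomputable def traceMoment (N : ℕ) (s : Multiset ℤ) : ℂ := ∫ U : UN N, trProd s U ∂haar N

theorem traceMoment_zero (N : ℕ) : traceMoment N 0 = 1 := by
  simp [traceMoment, trProd]

theorem trProd_cons (a : ℤ) (s : Multiset ℤ) (U : UN N) :
    trProd (a ::ₘ s) U = tr (U ^ a) * trProd s U := by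
  simp [trProd]

theorem traceMoment_zero_cons (N : ℕ) (s : Multiset ℤ) :
    traceMoment N (0 ::ₘ s) = N * traceMoment N s := by
  simp [traceMoment, trProd_cons, tr, integral_const_mul]

/-- Infinitesimal invariance under scalars `U ↦ exp (i t) U`: take `X = 1` and `k = 0`, so that the
chosen diagonal entry of `U ^ k` is `1`. -/
theorem sum_mul_traceMoment (hN : N ≠ 0) (s : Multiset ℤ) : (s.sum : ℂ) * traceMoment N s = 0 := by
  have h := integral_entryDeriv 0 s ⟨0, Nat.pos_of_ne_zero hN⟩ ⟨0, Nat.pos_of_ne_zero hN⟩ 1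
  rw [← h, traceMoment, ← integral_const_mul]
  congr 1
  ext U
  have hs : (s.sum : ℂ) = ∑ m ∈ s.toFinset, (s.count m : ℂ) * m := by
    conv_lhs => rw [← Multiset.map_id' s, Finset.sum_multiset_map_count]
    simp
  simp only [entryDeriv, Finset.range_zero, Finset.sum_empty, zero_mul, zero_add, pow_zero,
    OneMemClass.coe_one, Matrix.one_apply_eq, one_mul, hs, Finset.sum_mul]
  refine Finset.sum_congr rfl fun m hm => ?_
  conv_lhs => rw [← Multiset.cons_erase (Multiset.mem_toFinset.mp hm)]
  rw [trProd_cons, tr, Multiset.count_cons_self]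
  rw [← Multiset.cons_erase (Multiset.mem_toFinset.mp hm)]
  simp
  ring

/-- Summing over matrix units `E i j` turns entries into traces: `∑ (A E B) i j = tr A * tr B` gives
the cuts, and `∑ A i j * tr (E B) = tr (A B)` the joins. -/
theorem sum_entryDeriv_single (k : ℕ) (s : Multiset ℤ) (U : UN N) :
    ∑ i, ∑ j, entryDeriv k s i j (Matrix.single i j 1) U =
      ∑ l ∈ Finset.range k, trProd ((l : ℤ) ::ₘ ((k : ℤ) - l) ::ₘ s) U +
        ∑ m ∈ s.toFinset, s.count m * (m * trProd ((k + m) ::ₘ s.erase m) U) := by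
  have hcut : ∀ (A B : Matrix (Fin N) (Fin N) ℂ) (i j : Fin N),
      (A * Matrix.single i j (1 : ℂ) * B : Matrix (Fin N) (Fin N) ℂ) i j = A i i * B j j := by
    intro A B i j
    rw [Matrix.mul_assoc, Matrix.mul_apply, Finset.sum_eq_single i]
    · simp
    · intro b _ hb
      simp [Matrix.single_mul_apply_of_ne, hb]
    · simp
  simp only [entryDeriv, hcut, Finset.sum_add_distrib, Matrix.trace_single_mul, trProd_cons]
  congr 1
  · simp only [Finset.sum_mul]
    rw [Finset.sum_congr rfl fun i _ => Finset.sum_comm, Finset.sum_comm]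
    refine Finset.sum_congr rfl fun l hl => ?_
    have hl' : ((k : ℤ) - l) = ((k - l : ℕ) : ℤ) :=
      (Nat.cast_sub (Finset.mem_range.mp hl).le).symm
    rw [hl', zpow_natCast, zpow_natCast, tr, tr, Matrix.trace, Matrix.trace, ← mul_assoc,
      Finset.sum_mul_sum, Finset.sum_mul]
    refine Finset.sum_congr rfl fun i _ => ?_
    rw [Finset.sum_mul]
    rfl
  · simp only [Finset.mul_sum]
    rw [Finset.sum_congr rfl fun i _ => Finset.sum_comm, Finset.sum_comm]
    refine Finset.sum_congr rfl fun m _ => ?_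
    rw [zpow_add, zpow_natCast, tr, Submonoid.coe_mul, Matrix.trace]
    simp only [Matrix.diag_apply, Matrix.mul_apply, Finset.sum_mul, Finset.mul_sum]
    refine Finset.sum_congr rfl fun i _ => Finset.sum_congr rfl fun j _ => ?_
    simp
    ring

/-- The loop equations of the unitary group. -/
theorem traceMoment_loop (N k : ℕ) (s : Multiset ℤ) :
    ∑ l ∈ Finset.range k, traceMoment N ((l : ℤ) ::ₘ ((k : ℤ) - l) ::ₘ s) +
      (s.map fun m : ℤ => (m : ℂ) * traceMoment N ((k + m) ::ₘ s.erase m)).sum = 0 := by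
  have hint : ∀ t : Multiset ℤ, Integrable (trProd t) (haar N) := fun t =>
    integrable_of_continuous (continuous_trProd t)
  have h : ∫ U : UN N, ∑ i, ∑ j, entryDeriv k s i j (Matrix.single i j 1) U ∂haar N = 0 := by
    rw [integral_finsetSum _ fun i _ => integrable_finsetSum _ fun j _ =>
      integrable_of_continuous (continuous_entryDeriv ..)]
    refine Finset.sum_eq_zero fun i _ => ?_
    rw [integral_finsetSum _ fun j _ => integrable_of_continuous (continuous_entryDeriv ..)]
    exact Finset.sum_eq_zero fun j _ => integral_entryDeriv ..
  simp only [sum_entryDeriv_single] at h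
  rw [integral_add (integrable_finsetSum _ fun l _ => hint _)
    (integrable_finsetSum _ fun m _ => ((hint _).const_mul _).const_mul _),
    integral_finsetSum _ fun l _ => hint _,
    integral_finsetSum _ fun m _ => ((hint _).const_mul _).const_mul _] at h
  simp only [integral_const_mul] at h
  rw [Finset.sum_multiset_map_count]
  simpa only [nsmul_eq_mul] using! h

end UN

/-! ### Uniqueness for the loop equations -/

/-- The multiset of integers with positive part `lam` and negative part `-mu`. -/
def signedParts (lam mu : Multiset ℕ) : Multiset ℤ :=
  lam.map (fun x : ℕ => (x : ℤ)) + mu.map (fun x : ℕ => -(x : ℤ))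

theorem exists_eq_signedParts (s : Multiset ℤ) (hs : 0 ∉ s) :
    ∃ lam mu : Multiset ℕ, 0 ∉ lam ∧ 0 ∉ mu ∧ s = signedParts lam mu := by
  induction s using Multiset.induction_on with
  | empty => exact ⟨0, 0, by simp, by simp, by simp [signedParts]⟩
  | cons a s ih =>
    rw [Multiset.mem_cons, not_or] at hs
    obtain ⟨lam, mu, hl, hm, rfl⟩ := ih hs.2
    obtain ⟨k, rfl | rfl⟩ := a.eq_nat_or_neg
    · refine ⟨k ::ₘ lam, mu, ?_, hm, by simp [signedParts]⟩
      rw [Multiset.mem_cons, not_or]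
      exact ⟨fun h => hs.1 (by simp [← h]), hl⟩
    · refine ⟨lam, k ::ₘ mu, hl, ?_, by simp [signedParts]⟩
      rw [Multiset.mem_cons, not_or]
      exact ⟨fun h => hs.1 (by simp [← h]), hm⟩

theorem cons_signedParts (k : ℕ) (lam mu : Multiset ℕ) :
    (k : ℤ) ::ₘ signedParts lam mu = signedParts (k ::ₘ lam) mu := by
  simp [signedParts]

theorem neg_cons_signedParts (k : ℕ) (lam mu : Multiset ℕ) :
    -(k : ℤ) ::ₘ signedParts lam mu = signedParts lam (k ::ₘ mu) := by
  simp [signedParts]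

theorem erase_signedParts {k : ℕ} {lam : Multiset ℕ} (h : k ∈ lam) (mu : Multiset ℕ) :
    (signedParts lam mu).erase (k : ℤ) = signedParts (lam.erase k) mu := by
  conv_lhs => rw [← Multiset.cons_erase h, ← cons_signedParts, Multiset.erase_cons_head]

theorem neg_erase_signedParts {k : ℕ} {mu : Multiset ℕ} (h : k ∈ mu) (lam : Multiset ℕ) :
    (signedParts lam mu).erase (-(k : ℤ)) = signedParts lam (mu.erase k) := by
  conv_lhs => rw [← Multiset.cons_erase h, ← neg_cons_signedParts, Multiset.erase_cons_head]

/-- The homogeneous loop equations have only the trivial solution in degrees up to `N`. -/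
theorem eq_zero_of_loop {N : ℕ} {D : Multiset ℤ → ℂ} (h0 : D 0 = 0)
    (hz : ∀ s, D (0 ::ₘ s) = N * D s)
    (hloop : ∀ (k : ℕ) (s : Multiset ℤ),
      ∑ l ∈ Finset.range k, D ((l : ℤ) ::ₘ ((k : ℤ) - l) ::ₘ s) +
        (s.map fun m : ℤ => (m : ℂ) * D ((k + m) ::ₘ s.erase m)).sum = 0)
    (K : ℕ) (hK : K ≤ N) (lam mu : Multiset ℕ) (hl0 : 0 ∉ lam) (hm0 : 0 ∉ mu)
    (hl : lam.sum = K) (hm : mu.sum = K) : D (signedParts lam mu) = 0 := by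
  induction K using Nat.strong_induction_on generalizing lam mu with
  | _ K ih =>
  have hpos : ∀ {t : Multiset ℕ}, 0 ∉ t → ∀ {x}, x ∈ t → 0 < x := fun ht x hx =>
    Nat.pos_of_ne_zero fun h => ht (h ▸ hx)
  rcases Nat.eq_zero_or_pos K with rfl | hKpos
  · have hnil : ∀ t : Multiset ℕ, 0 ∉ t → t.sum = 0 → t = 0 := fun t ht hsum =>
      Multiset.eq_zero_of_forall_notMem fun x hx =>
        (hpos ht hx).ne' (Multiset.sum_eq_zero_iff.mp hsum x hx)
    rw [hnil lam hl0 hl, hnil mu hm0 hm]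
    simpa [signedParts] using h0
  -- With `mu` fixed, there are finitely many positive parts of size `K`; the loop equation is
  -- applied at one that maximises the norm.
  obtain ⟨p, hp⟩ := Finite.exists_max fun p : K.Partition => ‖D (signedParts p.parts mu)‖
  set M := ‖D (signedParts p.parts mu)‖ with hM
  have hbound : ∀ t : Multiset ℕ, 0 ∉ t → t.sum = K → ‖D (signedParts t mu)‖ ≤ M :=
    fun t ht hsum => hp ⟨t, fun hi => hpos ht hi, hsum⟩
  suffices hM0 : M ≤ 0 from norm_le_zero_iff.mp ((hbound lam hl0 hl).trans hM0)
  have hp0 : 0 ∉ p.parts := fun h => (p.parts_pos h).ne' rfl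
  obtain ⟨k, hk⟩ : ∃ k, k ∈ p.parts := by
    refine Multiset.exists_mem_of_ne_zero fun h => ?_
    have := p.parts_sum
    rw [h, Multiset.sum_zero] at this
    omega
  obtain ⟨q, hq⟩ := Multiset.exists_cons_of_mem hk
  obtain ⟨k, rfl⟩ : ∃ k', k = k' + 1 := ⟨k - 1, by have := p.parts_pos hk; omega⟩
  have hq0 : 0 ∉ q := fun h => hp0 (hq ▸ Multiset.mem_cons_of_mem h)
  have hqsum : k + 1 + q.sum = K := by
    rw [← Multiset.sum_cons, ← hq, p.parts_sum]
  have hcut : ∀ l ∈ Finset.range k,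
      ‖D (((l + 1 : ℕ) : ℤ) ::ₘ (((k + 1 : ℕ) : ℤ) - (l + 1 : ℕ)) ::ₘ signedParts q mu)‖ ≤ M := by
    intro l hl
    rw [Finset.mem_range] at hl
    rw [← Nat.cast_sub (by omega), cons_signedParts, cons_signedParts]
    apply hbound
    · simp only [Multiset.mem_cons, not_or]
      exact ⟨by omega, by omega, hq0⟩
    · simp only [Multiset.sum_cons]
      omega
  have hjoin : ∀ m ∈ q, ‖((m : ℤ) : ℂ) * D ((((k + 1 : ℕ) : ℤ) + (m : ℤ)) ::ₘ
      (signedParts q mu).erase (m : ℤ))‖ ≤ m * M := by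
    intro m hmq
    rw [erase_signedParts hmq, ← Nat.cast_add, cons_signedParts, norm_mul]
    have hsum : m + (q.erase m).sum = q.sum := by
      rw [← Multiset.sum_cons, Multiset.cons_erase hmq]
    have h1 := hbound ((k + 1 + m) ::ₘ q.erase m)
      (by
        simp only [Multiset.mem_cons, not_or]
        exact ⟨by omega, fun h => hq0 (Multiset.mem_of_mem_erase h)⟩)
      (by rw [Multiset.sum_cons]; omega)
    have h2 : ‖((m : ℤ) : ℂ)‖ = m := by simp
    rw [h2]
    exact mul_le_mul_of_nonneg_left h1 m.cast_nonneg
  -- Cancelling `k + 1` against `-m` lowers both total sizes by `min (k + 1) m`, so the induction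
  -- hypothesis applies.
  have hneg : ∀ m ∈ mu, ((-(m : ℤ) : ℤ) : ℂ) * D ((((k + 1 : ℕ) : ℤ) + -(m : ℤ)) ::ₘ
      (signedParts q mu).erase (-(m : ℤ))) = 0 := by
    intro m hmm
    have hmpos := hpos hm0 hmm
    have hsum : m + (mu.erase m).sum = mu.sum := by
      rw [← Multiset.sum_cons, Multiset.cons_erase hmm]
    have he0 : 0 ∉ mu.erase m := fun h => hm0 (Multiset.mem_of_mem_erase h)
    rw [neg_erase_signedParts hmm]
    refine mul_eq_zero_of_right _ ?_
    rcases lt_trichotomy (k + 1) m with h | h | h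
    · have e : ((k + 1 : ℕ) : ℤ) + -(m : ℤ) = -((m - (k + 1) : ℕ) : ℤ) := by omega
      rw [e, neg_cons_signedParts]
      refine ih (K - (k + 1)) (by omega) (by omega) _ _ hq0 ?_ (by omega) ?_
      · simp only [Multiset.mem_cons, not_or]
        exact ⟨by omega, he0⟩
      · rw [Multiset.sum_cons]
        omega
    · have e : ((k + 1 : ℕ) : ℤ) + -(m : ℤ) = 0 := by omega
      rw [e, hz, ih (K - m) (by omega) (by omega) _ _ hq0 he0 (by omega) (by omega), mul_zero]
    · have e : ((k + 1 : ℕ) : ℤ) + -(m : ℤ) = ((k + 1 - m : ℕ) : ℤ) := by omega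
      rw [e, cons_signedParts]
      refine ih (K - m) (by omega) (by omega) _ _ ?_ he0 ?_ (by omega)
      · simp only [Multiset.mem_cons, not_or]
        exact ⟨by omega, hq0⟩
      · rw [Multiset.sum_cons]
        omega
  have hmap : ((signedParts q mu).map fun m : ℤ =>
      (m : ℂ) * D ((((k + 1 : ℕ) : ℤ) + m) ::ₘ (signedParts q mu).erase m)).sum =
      (q.map fun m : ℕ => ((m : ℤ) : ℂ) * D ((((k + 1 : ℕ) : ℤ) + (m : ℤ)) ::ₘ
        (signedParts q mu).erase (m : ℤ))).sum := by
    conv_lhs => rw [signedParts, Multiset.map_add, Multiset.sum_add, Multiset.map_map,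
      Multiset.map_map]
    rw [← signedParts]
    simp only [Function.comp_def]
    rw [Multiset.map_congr rfl hneg]
    simp
  have hjoin' : ‖(q.map fun m : ℕ => ((m : ℤ) : ℂ) * D ((((k + 1 : ℕ) : ℤ) + (m : ℤ)) ::ₘ
        (signedParts q mu).erase (m : ℤ))).sum‖ ≤ q.sum * M := by
    refine (norm_multiset_sum_le _).trans ?_
    rw [Multiset.map_map]
    refine (Multiset.sum_map_le_sum_map _ (fun m : ℕ => (m : ℝ) * M) hjoin).trans_eq ?_
    rw [Multiset.sum_map_mul_right, Nat.cast_multiset_sum]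
  have hcut' := (norm_sum_le _ _).trans (Finset.sum_le_sum hcut)
  rw [Finset.sum_const, Finset.card_range, nsmul_eq_mul] at hcut'
  have hmain := hloop (k + 1) (signedParts q mu)
  -- The cut at `l = 0` gives back the maximiser with the factor `N`.
  rw [hmap, Finset.sum_range_succ', Nat.cast_zero, sub_zero, hz, cons_signedParts, ← hq] at hmain
  have hN : (N : ℂ) * D (signedParts p.parts mu) = -(
      ∑ l ∈ Finset.range k,
        D (((l + 1 : ℕ) : ℤ) ::ₘ (((k + 1 : ℕ) : ℤ) - (l + 1 : ℕ)) ::ₘ signedParts q mu) +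
      (q.map fun m : ℕ => ((m : ℤ) : ℂ) * D ((((k + 1 : ℕ) : ℤ) + (m : ℤ)) ::ₘ
        (signedParts q mu).erase (m : ℤ))).sum) := by
    linear_combination hmain
  have hnorm := congrArg norm hN
  rw [norm_mul, norm_neg, Complex.norm_natCast, ← hM] at hnorm
  have hle : (N : ℝ) * M ≤ k * M + q.sum * M :=
    hnorm.trans_le ((norm_add_le _ _).trans (add_le_add hcut' hjoin'))
  -- The weights `k` of cuts and `q.sum` of joins add up to `K - 1`, so `N M ≤ (K - 1) M` with `K ≤
  -- N` forces `M ≤ 0`.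
  have hNK : (k : ℝ) + 1 + q.sum ≤ N := by exact_mod_cast hqsum.trans_le hK
  have hM' : 0 ≤ M := norm_nonneg _
  nlinarith

/-! ### Comparison of the moments and explicit evaluation -/

theorem gaussianMoment_eq_zero {N : ℕ} {s : Multiset ℤ} {j : ℤ} (hj : 0 < j)
    (h : s.count j ≠ s.count (-j)) : gaussianMoment N s = 0 :=
  finprod_eq_zero _ j (by simp [gaussianFactor, hj, h]) (hasFiniteMulSupport_gaussianFactor N s)

/-- A nonzero moment forces `s` to be symmetric under negation, hence to have sum zero. -/
theorem gaussianMoment_eq_zero_of_sum_ne_zero {N : ℕ} {s : Multiset ℤ} (h : s.sum ≠ 0) :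
    gaussianMoment N s = 0 := by
  by_contra hne
  have hpos : ∀ j : ℤ, 0 < j → s.count j = s.count (-j) := fun j hj => by
    by_contra hc
    exact hne (gaussianMoment_eq_zero hj hc)
  have hs : s.map (fun m => -m) = s := by
    ext j
    have : (s.map fun m => -m).count j = s.count (-j) := by
      conv_lhs => rw [← neg_neg j]
      exact Multiset.count_map_eq_count' _ _ neg_injective _
    rw [this]
    rcases lt_trichotomy j 0 with hj | rfl | hj
    · simpa using hpos (-j) (by omega)
    · simp
    · exact (hpos j hj).symm
  have h2 := congrArg Multiset.sum hs
  rw [Multiset.sum_map_neg'] at h2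
  omega

/-- Stable trace moments of the unitary group are Gaussian. -/
theorem UN.traceMoment_eq_gaussianMoment {N : ℕ} (hN : N ≠ 0) (s : Multiset ℤ) (hs : 0 ∉ s)
    (hsum : (s.map fun m => |m|).sum ≤ 2 * (N : ℤ)) :
    traceMoment N s = gaussianMoment N s := by
  by_cases h : s.sum = 0
  · obtain ⟨lam, mu, hl, hm, rfl⟩ := exists_eq_signedParts s hs
    have h1 : (signedParts lam mu).sum = (lam.sum : ℤ) - mu.sum := by
      simp [signedParts, Nat.cast_multiset_sum, sub_eq_add_neg]
    have h2 : ((signedParts lam mu).map fun m => |m|).sum = (lam.sum : ℤ) + mu.sum := by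
      simp [signedParts, Nat.cast_multiset_sum]
    rw [← sub_eq_zero]
    -- Since `lam.sum = mu.sum`, the bound `2 * N` on their total gives `lam.sum ≤ N`.
    refine eq_zero_of_loop (N := N) (D := fun s => traceMoment N s - gaussianMoment N s) ?_ ?_ ?_
      lam.sum (by omega) lam mu hl hm rfl (by omega)
    · simp [traceMoment_zero, gaussianMoment_zero]
    · intro s
      simp only [traceMoment_zero_cons, gaussianMoment_zero_cons]
      ring
    · intro k s
      simp only [mul_sub, Finset.sum_sub_distrib, Multiset.sum_map_sub]
      linear_combination traceMoment_loop N k s - gaussianMoment_loop N k s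
  · rw [gaussianMoment_eq_zero_of_sum_ne_zero h]
    exact (mul_eq_zero.mp (sum_mul_traceMoment hN s)).resolve_left (by exact_mod_cast h)

theorem gaussianMoment_eq_prod {ι : Type*} [Fintype ι] (N : ℕ) {t : Multiset ℤ} (ht : 0 ∉ t)
    {s : ι → ℤ} (hs : Function.Injective s) (hpos : ∀ j, 0 < s j)
    (hmem : ∀ x ∈ t, |x| ∈ Set.range s) :
    gaussianMoment N t = if ∀ j, t.count (s j) = t.count (-s j) then
      ∏ j, (Nat.factorial (t.count (s j)) : ℂ) * (s j : ℂ) ^ t.count (s j) else 0 := by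
  classical
  have hsupp : Function.mulSupport (gaussianFactor N t) ⊆ (Finset.univ.image s : Finset ℤ) := by
    intro j hj
    by_contra hn
    have hn' : j ∉ Set.range s := by simpa using hn
    refine hj ?_
    unfold gaussianFactor
    split_ifs with h1 h2 h3
    · have : j ∉ t := fun h => hn' (abs_of_pos h1 ▸ hmem j h)
      simp [Multiset.count_eq_zero_of_notMem this]
    · have h4 : j ∉ t := fun h => hn' (abs_of_pos h1 ▸ hmem j h)
      have h5 : -j ∉ t := fun h => hn' (by simpa [abs_of_pos h1] using hmem (-j) h)
      simp [Multiset.count_eq_zero_of_notMem h4, Multiset.count_eq_zero_of_notMem h5] at h2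
    · simp [Multiset.count_eq_zero_of_notMem ht]
    · rfl
  rw [gaussianMoment, finprod_eq_prod_of_mulSupport_subset _ hsupp,
    Finset.prod_image fun _ _ _ _ h => hs h]
  simp only [gaussianFactor, hpos, if_true, Finset.prod_ite_zero, Finset.mem_univ, true_imp_iff]

theorem theorem2 (n N : ℕ) (hN : N ≠ 0) (r : Fin n → ℤ) (hr : ∀ i, r i ≠ 0)
    (hsum : ∑ i, |r i| ≤ 2 * (N : ℤ))
    (m : ℕ) (s : Fin m → ℤ) (hs : Function.Injective s)
    (hsr : Set.range s = Set.range fun i => |r i|)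
    (a b : Fin m → ℕ)
    (ha : ∀ j, a j = Fintype.card {i : Fin n // r i = s j})
    (hb : ∀ j, b j = Fintype.card {i : Fin n // r i = -s j}) :
    UN.avgTraceProd r N =
      if ∀ j, a j = b j then ∏ j, (Nat.factorial (a j) : ℂ) * (s j : ℂ) ^ a j else 0 := by
  set t : Multiset ℤ := Finset.univ.val.map r with ht
  have ht0 : 0 ∉ t := by
    simpa [ht] using hr
  have hcount : ∀ x, t.count x = Fintype.card {i : Fin n // r i = x} := by
    intro x
    rw [ht, Multiset.count_map, Fintype.card_subtype, Finset.card_def, Finset.filter_val]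
    simp only [eq_comm]
  have hE : UN.avgTraceProd r N = UN.traceMoment N t := by
    simp [UN.avgTraceProd, UN.traceMoment, UN.trProd, ht, Finset.prod_eq_multiset_prod,
      Function.comp_def]
  have hpos : ∀ j, 0 < s j := by
    intro j
    obtain ⟨i, hi⟩ := hsr ▸ Set.mem_range_self j
    exact hi ▸ abs_pos.mpr (hr i)
  have hmem : ∀ x ∈ t, |x| ∈ Set.range s := by
    intro x hx
    obtain ⟨i, -, rfl⟩ := Multiset.mem_map.mp hx
    exact hsr ▸ ⟨i, rfl⟩
  rw [hE, UN.traceMoment_eq_gaussianMoment hN t ht0, gaussianMoment_eq_prod N ht0 hs hpos hmem]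
  · simp only [hcount, ← ha, ← hb]
  · simpa [ht, Finset.sum_eq_multiset_sum, Multiset.map_map, Function.comp_def] using hsum
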